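/- Call a word ordered if its distinct letters make their first appearances in increasing order, and Carlitz if any two adjacent letters are different. A word of $0^j,1^4,\ldots,n^4$ is a word containing the letter $0$ exactly $j$ times, each of the letters $1,\ldots,n$ exactly four times, and no other letter. Consider rational sequences $(p_n)_{n\ge0}$, $(q_n)_{n\ge0}$, $(r_n)_{n\ge0}$ with $p_0=1$, $p_1=0$, $q_0=0$, $r_0=0$ and, for all $n\ge 1$, $$ \begin{aligned} 3p_{n+1}&=(4n+1)q_n+3\bigl(10q_{n-1}-r_n+4r_{n-1}+(6n+7)p_n+p_{n-1}\bigr),\\ 2q_n&=(4n+6)r_n+6r_{n-1}-(16n+6)p_n,\\ r_n&=(4n+3)p_n+3q_{n-1}. \end{aligned} $$ There is exactly one such triple of sequences, and for every $n\ge0$ the numbers $p_n$, $q_n$ and $r_n$ count, respectively, the ordered Carlitz words of $1^4,\ldots,n^4$, those of $0^3,1^4,\ldots,n^4$, and those of $0^2,1^4,\ldots,n^4$. -/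

import Mathlib

/-- A word is Carlitz if adjacent letters are different. -/
def IsCarlitz (w : List ℕ) : Prop :=
  w.IsChain (fun a b => a ≠ b)

/-- A word is ordered if its letters make their first appearances in increasing order. -/
def IsOrdered (w : List ℕ) : Prop :=
  ∀ a ∈ w, ∀ b ∈ w, a < b → w.idxOf a < w.idxOf b

open Classical in
/-- The finite set of ordered Carlitz words that are arrangements of the multiset `m`. -/
noncomputable def orderedCarlitzWords (m : Multiset ℕ) : Finset (List ℕ) :=
  m.lists.toFinset.filter (fun w => IsCarlitz w ∧ IsOrdered w)

/-- The multiset with `j` copies of the letter `0` and four copies of each of `1, …, n`. -/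
def letters (j n : ℕ) : Multiset ℕ :=
  Multiset.replicate j 0 + ∑ i ∈ Finset.Icc 1 n, Multiset.replicate 4 i

/-- The number of ordered Carlitz words of `0 ^ j, 1 ^ 4, …, n ^ 4`. -/
noncomputable def orderedCarlitzCount (j n : ℕ) : ℕ :=
  (orderedCarlitzWords (letters j n)).card

/-- The initial values and the coupled recurrences for `p`, `q`, `r`. -/
structure SatisfiesRecurrences (p q r : ℕ → ℚ) : Prop where
  p_zero : p 0 = 1
  p_one : p 1 = 0
  q_zero : q 0 = 0
  r_zero : r 0 = 0
  p_rec : ∀ n : ℕ, 1 ≤ n →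
    3 * p (n + 1) = (4 * n + 1) * q n
      + 3 * (10 * q (n - 1) - r n + 4 * r (n - 1) + (6 * n + 7) * p n + p (n - 1))
  q_rec : ∀ n : ℕ, 1 ≤ n →
    2 * q n = (4 * n + 6) * r n + 6 * r (n - 1) - (16 * n + 6) * p n
  r_rec : ∀ n : ℕ, 1 ≤ n →
    r n = (4 * n + 3) * p n + 3 * q (n - 1)

/-! Let Φ be the functional X ^ k ↦ k! and P_k the polynomials `carlitzPoly k`. For letters of
multiplicities m_i, the number of Carlitz words is Φ(∏ P_{m_i}). Integration by parts turns this
into a sum over letters a of Φ applied to the product with the factor of a differentiated, and that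
summand counts the words starting with a. Indeed, deleting the first a leaves a word that does not
start with a, which is exactly P_{k+1}' = P_k - P_k'. Since n letters of equal multiplicity are
interchangeable, ordering them divides the count by n! (`card_carlitzWordsFrom_and_head`).

Hence n! p_n = Φ(P_4 ^ n), while n! q_n and n! r_n are Φ(P_3' P_4 ^ n) and Φ(P_2' P_4 ^ n), because
an ordered word containing 0 must start with it. The recurrences among these moments follow by
creative telescoping (`carlitzMoment_eq_zero_of_certificate`), and they determine the sequences. -/

open Polynomial in
/-- The linear functional `X ^ k ↦ k !` on polynomials, that is `p ↦ ∫₀^∞ p(t) exp(-t) dt`. -/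
noncomputable def factorialFunctional : ℚ[X] →ₗ[ℚ] ℚ :=
  Polynomial.lsum fun k => (k.factorial : ℚ) • LinearMap.id

open Polynomial in
/-- The antiderivative of a polynomial with vanishing constant term. -/
noncomputable def antiderivative : ℚ[X] →ₗ[ℚ] ℚ[X] :=
  Polynomial.lsum fun k => ((k : ℚ) + 1)⁻¹ • Polynomial.monomial (k + 1)

open Polynomial in
/-- The polynomials `∑ⱼ (-1) ^ (k - j) * (k - 1).choose (j - 1) * X ^ j / j !`, whose products
encode the numbers of Carlitz words with prescribed letter multiplicities. -/
noncomputable def carlitzPoly : ℕ → ℚ[X]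
  | 0 => 1
  | k + 1 => antiderivative (carlitzPoly k - derivative (carlitzPoly k))

/-! ### The functional and the polynomials P_k -/

section Polynomials

open Polynomial

theorem factorialFunctional_monomial (k : ℕ) (a : ℚ) :
    factorialFunctional (monomial k a) = k.factorial * a := by
  simp [factorialFunctional, Polynomial.lsum_apply, Polynomial.sum_monomial_index]

theorem antiderivative_monomial (k : ℕ) (a : ℚ) :
    antiderivative (monomial k a) = monomial (k + 1) (((k : ℚ) + 1)⁻¹ * a) := by
  simp [antiderivative, Polynomial.lsum_apply, Polynomial.sum_monomial_index,
    Polynomial.smul_monomial]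

/-- Integration by parts for the functional `p ↦ ∫₀^∞ p(t) exp(-t) dt`. -/
theorem factorialFunctional_eq_eval_add_derivative (p : ℚ[X]) :
    factorialFunctional p = p.eval 0 + factorialFunctional (derivative p) := by
  induction p using Polynomial.induction_on' with
  | add p q hp hq => simp only [map_add, eval_add, hp, hq]; ring
  | monomial k a =>
    cases k with
    | zero =>
      rw [factorialFunctional_monomial]
      simp
    | succ k =>
      rw [derivative_monomial, factorialFunctional_monomial, factorialFunctional_monomial,
        Nat.factorial_succ]
      simp [eval_monomial]
      ring

theorem derivative_antiderivative (p : ℚ[X]) : derivative (antiderivative p) = p := by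
  induction p using Polynomial.induction_on' with
  | add p q hp hq => simp only [map_add, hp, hq]
  | monomial k a =>
    have hk : (k : ℚ) + 1 ≠ 0 := by positivity
    rw [antiderivative_monomial, derivative_monomial]
    congr 1
    push_cast
    field_simp

theorem eval_zero_antiderivative (p : ℚ[X]) : (antiderivative p).eval 0 = 0 := by
  induction p using Polynomial.induction_on' with
  | add p q hp hq => simp only [map_add, eval_add, hp, hq, add_zero]
  | monomial k a => simp [antiderivative_monomial, eval_monomial]

theorem antiderivative_eq {p q : ℚ[X]} (h : derivative q = p) (h0 : q.eval 0 = 0) :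
    antiderivative p = q := by
  have hd : derivative (antiderivative p - q) = 0 := by
    rw [derivative_sub, derivative_antiderivative, h, sub_self]
  have hc := Polynomial.eq_C_of_derivative_eq_zero hd
  have he : (antiderivative p - q).eval 0 = 0 := by
    rw [eval_sub, eval_zero_antiderivative, h0, sub_self]
  rw [hc, eval_C] at he
  rw [he, map_zero] at hc
  exact sub_eq_zero.mp hc

theorem derivative_carlitzPoly_succ (k : ℕ) :
    derivative (carlitzPoly (k + 1)) = carlitzPoly k - derivative (carlitzPoly k) :=
  derivative_antiderivative _

theorem eval_zero_carlitzPoly {k : ℕ} (hk : k ≠ 0) : (carlitzPoly k).eval 0 = 0 := by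
  obtain ⟨k, rfl⟩ := Nat.exists_eq_succ_of_ne_zero hk
  exact eval_zero_antiderivative _

theorem carlitzPoly_one : carlitzPoly 1 = X := by
  apply antiderivative_eq <;> simp [carlitzPoly]

theorem carlitzPoly_two : carlitzPoly 2 = C (1 / 2) * X ^ 2 - X := by
  apply antiderivative_eq
  · rw [carlitzPoly_one]
    apply Polynomial.funext
    intro t
    simp
    ring
  · simp

theorem carlitzPoly_three : carlitzPoly 3 = C (1 / 6) * X ^ 3 - X ^ 2 + X := by
  apply antiderivative_eq
  · rw [carlitzPoly_two]
    apply Polynomial.funext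
    intro t
    simp
    ring
  · simp

theorem carlitzPoly_four :
    carlitzPoly 4 = C (1 / 24) * X ^ 4 - C (1 / 2) * X ^ 3 + C (3 / 2) * X ^ 2 - X := by
  apply antiderivative_eq
  · rw [carlitzPoly_three]
    apply Polynomial.funext
    intro t
    simp
    ring
  · simp

/-! ### Recurrences for the moments -/

/-- The value on `f * carlitzPoly 4 ^ n` of the functional. -/
noncomputable def carlitzMoment (f : ℚ[X]) (n : ℕ) : ℚ :=
  factorialFunctional (f * carlitzPoly 4 ^ n)

/-- With F = G P_4 ^ (n + 1), the hypothesis says f P_4 ^ n = F' - F. Integration by parts sends F'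
- F to -F(0), which vanishes because P_4(0) = 0. -/
theorem carlitzMoment_eq_zero_of_certificate {f G : ℚ[X]} (n : ℕ)
    (h : f = (derivative G - G) * carlitzPoly 4
      + C ((n : ℚ) + 1) * G * derivative (carlitzPoly 4)) :
    carlitzMoment f n = 0 := by
  have hF := factorialFunctional_eq_eval_add_derivative (G * carlitzPoly 4 ^ (n + 1))
  have h0 : (G * carlitzPoly 4 ^ (n + 1)).eval 0 = 0 := by
    simp [eval_zero_carlitzPoly]
  have hd : derivative (G * carlitzPoly 4 ^ (n + 1))
      = G * carlitzPoly 4 ^ (n + 1) + f * carlitzPoly 4 ^ n := by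
    rw [h, derivative_mul, derivative_pow]
    push_cast
    simp only [map_add, map_natCast, map_one]
    ring
  rw [h0, hd, map_add] at hF
  unfold carlitzMoment
  linarith

theorem carlitzMoment_add (f g : ℚ[X]) (n : ℕ) :
    carlitzMoment (f + g) n = carlitzMoment f n + carlitzMoment g n := by
  simp [carlitzMoment, add_mul]

theorem carlitzMoment_C_mul (a : ℚ) (f : ℚ[X]) (n : ℕ) :
    carlitzMoment (C a * f) n = a * carlitzMoment f n := by
  simp [carlitzMoment, ← smul_eq_C_mul]

theorem carlitzMoment_mul_carlitzPoly (f : ℚ[X]) (n : ℕ) :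
    carlitzMoment (f * carlitzPoly 4) n = carlitzMoment f (n + 1) := by
  rw [carlitzMoment, carlitzMoment, pow_succ', mul_assoc]

theorem carlitzMoment_two_rec (n : ℕ) :
    carlitzMoment (derivative (carlitzPoly 2)) (n + 1)
      = (4 * (n + 1) + 3) * carlitzMoment 1 (n + 1)
        + 3 * (n + 1) * carlitzMoment (derivative (carlitzPoly 3)) n := by
  -- The certificate condition is linear in the coefficients of `G`; the given `G` is a solution
  -- depending polynomially on n.
  have h := carlitzMoment_eq_zero_of_certificate
    (f := derivative (carlitzPoly 2) * carlitzPoly 4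
      + C (-(4 * ((n : ℚ) + 1) + 3)) * (1 * carlitzPoly 4)
      + C (-(3 * ((n : ℚ) + 1))) * derivative (carlitzPoly 3)) (G := C 3 - X) n (by
    rw [carlitzPoly_two, carlitzPoly_three, carlitzPoly_four]
    apply Polynomial.funext
    intro t
    simp
    ring)
  simp only [carlitzMoment_add, carlitzMoment_C_mul, carlitzMoment_mul_carlitzPoly] at h
  linarith

theorem carlitzMoment_three_rec (n : ℕ) :
    2 * carlitzMoment (derivative (carlitzPoly 3)) (n + 1)
      = (4 * (n + 1) + 6) * carlitzMoment (derivative (carlitzPoly 2)) (n + 1)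
        + 6 * (n + 1) * carlitzMoment (derivative (carlitzPoly 2)) n
        - (16 * (n + 1) + 6) * carlitzMoment 1 (n + 1) := by
  have h := carlitzMoment_eq_zero_of_certificate
    (f := C 2 * (derivative (carlitzPoly 3) * carlitzPoly 4)
      + C (-(4 * ((n : ℚ) + 1) + 6)) * (derivative (carlitzPoly 2) * carlitzPoly 4)
      + C (16 * ((n : ℚ) + 1) + 6) * (1 * carlitzPoly 4)
      + C (-(6 * ((n : ℚ) + 1))) * derivative (carlitzPoly 2))
    (G := C (-6) + C 8 * X - X ^ 2) n (by
    rw [carlitzPoly_two, carlitzPoly_three, carlitzPoly_four]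
    apply Polynomial.funext
    intro t
    simp
    ring)
  simp only [carlitzMoment_add, carlitzMoment_C_mul, carlitzMoment_mul_carlitzPoly] at h
  linarith

theorem carlitzMoment_one_rec (n : ℕ) :
    3 * carlitzMoment 1 (n + 2)
      = (n + 2) * ((4 * (n + 1) + 1) * carlitzMoment (derivative (carlitzPoly 3)) (n + 1)
        - 3 * carlitzMoment (derivative (carlitzPoly 2)) (n + 1)
        + 3 * (6 * (n + 1) + 7) * carlitzMoment 1 (n + 1))
        + 3 * (n + 2) * (n + 1) * (10 * carlitzMoment (derivative (carlitzPoly 3)) n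
          + 4 * carlitzMoment (derivative (carlitzPoly 2)) n + carlitzMoment 1 n) := by
  -- Three consecutive indices occur, so everything is written over P_4 ^ n. The factors n + 2 and n
  -- + 1 come from clearing the factorials.
  have h := carlitzMoment_eq_zero_of_certificate
    (f := C 3 * (1 * carlitzPoly 4 * carlitzPoly 4)
      + C (-(((n : ℚ) + 2) * (4 * (n + 1) + 1))) * (derivative (carlitzPoly 3) * carlitzPoly 4)
      + C (3 * ((n : ℚ) + 2)) * (derivative (carlitzPoly 2) * carlitzPoly 4)
      + C (-(3 * ((n : ℚ) + 2) * (6 * (n + 1) + 7))) * (1 * carlitzPoly 4)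
      + C (-(30 * ((n : ℚ) + 2) * (n + 1))) * derivative (carlitzPoly 3)
      + C (-(12 * ((n : ℚ) + 2) * (n + 1))) * derivative (carlitzPoly 2)
      + C (-(3 * ((n : ℚ) + 2) * (n + 1))) * 1)
    (G := C (21 * ((n : ℚ) + 2)) - C (7 * ((n : ℚ) + 1) + 4) * X
      + C (7 / 2 * ((n : ℚ) + 1) - 1) * X ^ 2 + C (1 - ((n : ℚ) + 1) / 2) * X ^ 3
      - C (1 / 8) * X ^ 4) n (by
    rw [carlitzPoly_two, carlitzPoly_three, carlitzPoly_four]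
    apply Polynomial.funext
    intro t
    simp
    ring)
  simp only [carlitzMoment_add, carlitzMoment_C_mul, carlitzMoment_mul_carlitzPoly] at h
  linarith

theorem satisfiesRecurrences_carlitzMoment :
    SatisfiesRecurrences (fun n => carlitzMoment 1 n / n.factorial)
      (fun n => carlitzMoment (derivative (carlitzPoly 3)) n / n.factorial)
      (fun n => carlitzMoment (derivative (carlitzPoly 2)) n / n.factorial) where
  p_zero := by
    have h := factorialFunctional_monomial 0 1
    simpa [carlitzMoment] using h
  p_one := by
    have h1 := factorialFunctional_monomial 1 1
    have h2 := factorialFunctional_monomial 2 (3 / 2)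
    have h3 := factorialFunctional_monomial 3 (1 / 2)
    have h4 := factorialFunctional_monomial 4 (1 / 24)
    simp only [← C_mul_X_pow_eq_monomial] at h1 h2 h3 h4
    simp only [carlitzMoment, carlitzPoly_four, one_mul, pow_one, map_sub, map_add, h2, h3, h4]
    simp only [map_one, one_mul, pow_one] at h1
    rw [h1]
    norm_num [Nat.factorial]
  q_zero := by
    have h0 := factorialFunctional_monomial 0 1
    have h1 := factorialFunctional_monomial 1 2
    have h2 := factorialFunctional_monomial 2 (1 / 2)
    simp only [← C_mul_X_pow_eq_monomial] at h0 h1 h2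
    have hd : derivative (carlitzPoly 3) = C (1 / 2) * X ^ 2 - C 2 * X ^ 1 + C 1 * X ^ 0 := by
      rw [carlitzPoly_three]
      apply Polynomial.funext
      intro t
      simp
      ring
    simp only [carlitzMoment, hd, pow_zero (carlitzPoly 4), mul_one (_ + _), map_sub, map_add,
      h0, h1, h2]
    norm_num [Nat.factorial]
  r_zero := by
    have h0 := factorialFunctional_monomial 0 1
    have h1 := factorialFunctional_monomial 1 1
    simp only [← C_mul_X_pow_eq_monomial] at h0 h1
    have hd : derivative (carlitzPoly 2) = C 1 * X ^ 1 - C 1 * X ^ 0 := by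
      rw [carlitzPoly_two]
      apply Polynomial.funext
      intro t
      simp
      ring
    simp only [carlitzMoment, hd, pow_zero (carlitzPoly 4), mul_one (_ - _), map_sub, h0, h1]
    norm_num [Nat.factorial]
  p_rec := by
    intro n hn
    obtain ⟨n, rfl⟩ := Nat.exists_eq_add_of_le' hn
    have h := carlitzMoment_one_rec n
    have hf : (n.factorial : ℚ) ≠ 0 := by positivity
    have h1 : (n : ℚ) + 1 ≠ 0 := by positivity
    have h2 : (n : ℚ) + 1 + 1 ≠ 0 := by positivity
    simp only [Nat.add_sub_cancel, Nat.factorial_succ]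
    push_cast
    field_simp
    linear_combination h
  q_rec := by
    intro n hn
    obtain ⟨n, rfl⟩ := Nat.exists_eq_add_of_le' hn
    have h := carlitzMoment_three_rec n
    have hf : (n.factorial : ℚ) ≠ 0 := by positivity
    have h1 : (n : ℚ) + 1 ≠ 0 := by positivity
    simp only [Nat.add_sub_cancel, Nat.factorial_succ]
    push_cast
    field_simp
    linear_combination h
  r_rec := by
    intro n hn
    obtain ⟨n, rfl⟩ := Nat.exists_eq_add_of_le' hn
    have h := carlitzMoment_two_rec n
    have hf : (n.factorial : ℚ) ≠ 0 := by positivity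
    have h1 : (n : ℚ) + 1 ≠ 0 := by positivity
    simp only [Nat.add_sub_cancel, Nat.factorial_succ]
    push_cast
    field_simp
    linear_combination h

end Polynomials

/-! ### Uniqueness -/

theorem SatisfiesRecurrences.unique {p q r p' q' r' : ℕ → ℚ}
    (h : SatisfiesRecurrences p q r) (h' : SatisfiesRecurrences p' q' r') (n : ℕ) :
    p n = p' n ∧ q n = q' n ∧ r n = r' n := by
  -- The value at n + 1 is carried along because r and q at n + 1 are computed from p at n + 1.
  suffices H : p n = p' n ∧ q n = q' n ∧ r n = r' n ∧ p (n + 1) = p' (n + 1) from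
    ⟨H.1, H.2.1, H.2.2.1⟩
  induction n with
  | zero =>
    exact ⟨h.p_zero.trans h'.p_zero.symm, h.q_zero.trans h'.q_zero.symm,
      h.r_zero.trans h'.r_zero.symm, h.p_one.trans h'.p_one.symm⟩
  | succ n ih =>
    obtain ⟨hp, hq, hr, hp1⟩ := ih
    have hr1 : r (n + 1) = r' (n + 1) := by
      rw [h.r_rec (n + 1) (by omega), h'.r_rec (n + 1) (by omega), Nat.add_sub_cancel, hp1, hq]
    have hq1 : q (n + 1) = q' (n + 1) := by
      have e := h.q_rec (n + 1) (by omega)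
      have e' := h'.q_rec (n + 1) (by omega)
      rw [Nat.add_sub_cancel, hp1, hr1, hr] at e
      rw [Nat.add_sub_cancel] at e'
      linarith
    have hp2 : p (n + 1 + 1) = p' (n + 1 + 1) := by
      have e := h.p_rec (n + 1) (by omega)
      have e' := h'.p_rec (n + 1) (by omega)
      rw [Nat.add_sub_cancel, hp1, hr1, hr, hq1, hq, hp] at e
      rw [Nat.add_sub_cancel] at e'
      linarith
    exact ⟨hp1, hq1, hr1, hp2⟩

/-! ### Ordered Carlitz words and their first letters -/

/-- The letters of `w` that are at least `h` make their first appearances in increasing order. -/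
def IsOrderedFrom (h : ℕ) (w : List ℕ) : Prop :=
  ∀ a ∈ w, ∀ b ∈ w, h ≤ a → a < b → w.idxOf a < w.idxOf b

theorem isOrderedFrom_cons_of_lt {h a : ℕ} {w : List ℕ} (ha : a < h) :
    IsOrderedFrom h (a :: w) ↔ IsOrderedFrom h w := by
  constructor
  · intro H x hx y hy hhx hxy
    have := H x (List.mem_cons_of_mem _ hx) y (List.mem_cons_of_mem _ hy) hhx hxy
    rwa [List.idxOf_cons_ne _ (by omega), List.idxOf_cons_ne _ (by omega),
      Nat.succ_lt_succ_iff] at this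
  · intro H x hx y hy hhx hxy
    rw [List.idxOf_cons_ne _ (by omega), List.idxOf_cons_ne _ (by omega), Nat.succ_lt_succ_iff]
    refine H x ?_ y ?_ hhx hxy
    · exact (List.mem_cons.mp hx).resolve_left (by omega)
    · exact (List.mem_cons.mp hy).resolve_left (by omega)

theorem isOrderedFrom_cons_self {h : ℕ} {w : List ℕ} :
    IsOrderedFrom h (h :: w) ↔ IsOrderedFrom (h + 1) w := by
  constructor
  · intro H x hx y hy hhx hxy
    have := H x (List.mem_cons_of_mem _ hx) y (List.mem_cons_of_mem _ hy) (by omega) hxy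
    rwa [List.idxOf_cons_ne _ (by omega), List.idxOf_cons_ne _ (by omega),
      Nat.succ_lt_succ_iff] at this
  · intro H x hx y hy hhx hxy
    rw [List.idxOf_cons_ne (a := y) _ (by omega)]
    rcases eq_or_lt_of_le hhx with rfl | hlt
    · rw [List.idxOf_cons_self]
      exact Nat.succ_pos _
    · rw [List.idxOf_cons_ne _ (by omega), Nat.succ_lt_succ_iff]
      refine H x ?_ y ?_ hlt hxy
      · exact (List.mem_cons.mp hx).resolve_left (by omega)
      · exact (List.mem_cons.mp hy).resolve_left (by omega)

theorem IsOrderedFrom.le_of_cons {h a : ℕ} {w : List ℕ} (H : IsOrderedFrom h (a :: w))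
    (hh : h ∈ a :: w) : a ≤ h := by
  by_contra! hlt
  have := H h hh a List.mem_cons_self le_rfl hlt
  rw [List.idxOf_cons_self] at this
  omega

theorem isOrdered_iff_isOrderedFrom_one {w : List ℕ} (h0 : 0 ∉ w) :
    IsOrdered w ↔ IsOrderedFrom 1 w := by
  constructor
  · intro H a ha b hb _ hab
    exact H a ha b hb hab
  · intro H a ha b hb hab
    exact H a ha b hb (Nat.one_le_iff_ne_zero.mpr fun h => h0 (h ▸ ha)) hab

theorem isOrdered_iff_head_eq_zero {w : List ℕ} (h0 : 0 ∈ w) :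
    IsOrdered w ↔ IsOrderedFrom 1 w ∧ w.head? = some 0 := by
  cases w with
  | nil => simp at h0
  | cons x w =>
    constructor
    · intro H
      refine ⟨fun a ha b hb _ hab => H a ha b hb hab, ?_⟩
      have hx : IsOrderedFrom 0 (x :: w) := fun a ha b hb _ hab => H a ha b hb hab
      simpa using hx.le_of_cons h0
    · rintro ⟨H, hx⟩ a ha b hb hab
      obtain rfl : x = 0 := by simpa using hx
      rcases Nat.eq_zero_or_pos a with rfl | hpos
      · rw [List.idxOf_cons_self, List.idxOf_cons_ne _ (by omega)]
        exact Nat.succ_pos _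
      · exact H a ha b hb hpos hab

theorem isCarlitz_cons {a : ℕ} {w : List ℕ} :
    IsCarlitz (a :: w) ↔ IsCarlitz w ∧ w.head? ≠ some a := by
  cases w with
  | nil => simp [IsCarlitz]
  | cons b w =>
    simp only [IsCarlitz, List.isChain_cons_cons, List.head?_cons, ne_eq, Option.some.injEq]
    exact ⟨fun H => ⟨H.2, fun e => H.1 e.symm⟩, fun H => ⟨fun e => H.2 e.symm, H.1⟩⟩

open Classical in
/-- The Carlitz arrangements of `m` whose letters from `h` on appear in increasing order. -/
noncomputable def carlitzWordsFrom (m : Multiset ℕ) (h : ℕ) : Finset (List ℕ) :=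
  m.lists.toFinset.filter fun w => IsCarlitz w ∧ IsOrderedFrom h w

open Classical in
/-- The words of `carlitzWordsFrom m h` with first letter `a`. -/
noncomputable def carlitzWordsFromHead (m : Multiset ℕ) (h a : ℕ) : Finset (List ℕ) :=
  (carlitzWordsFrom m h).filter fun w => w.head? = some a

theorem mem_carlitzWordsFrom {m : Multiset ℕ} {h : ℕ} {w : List ℕ} :
    w ∈ carlitzWordsFrom m h ↔ (w : Multiset ℕ) = m ∧ IsCarlitz w ∧ IsOrderedFrom h w := by
  simp [carlitzWordsFrom, Multiset.mem_lists_iff, eq_comm]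

theorem mem_carlitzWordsFromHead {m : Multiset ℕ} {h a : ℕ} {w : List ℕ} :
    w ∈ carlitzWordsFromHead m h a ↔ w ∈ carlitzWordsFrom m h ∧ w.head? = some a := by
  simp [carlitzWordsFromHead]

theorem carlitzWordsFromHead_eq_empty_of_notMem {m : Multiset ℕ} {h a : ℕ} (ha : a ∉ m) :
    carlitzWordsFromHead m h a = ∅ := by
  refine Finset.eq_empty_of_forall_notMem fun w hw => ha ?_
  rw [mem_carlitzWordsFromHead, mem_carlitzWordsFrom] at hw
  rw [← hw.1.1, Multiset.mem_coe]
  exact List.mem_of_mem_head? hw.2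

theorem carlitzWordsFromHead_eq_empty_of_lt {m : Multiset ℕ} {h a : ℕ} (hm : h ∈ m)
    (ha : h < a) : carlitzWordsFromHead m h a = ∅ := by
  refine Finset.eq_empty_of_forall_notMem fun w hw => ?_
  rw [mem_carlitzWordsFromHead, mem_carlitzWordsFrom] at hw
  obtain ⟨⟨rfl, -, ho⟩, hh⟩ := hw
  obtain ⟨w, rfl⟩ := List.head?_eq_some_iff.mp hh
  exact absurd (ho.le_of_cons hm) (by omega)

theorem card_carlitzWordsFrom_eq_sum {m : Multiset ℕ} {h N : ℕ} (hm : m ≠ 0)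
    (hN : ∀ i ∈ m, i < N) :
    (carlitzWordsFrom m h).card = ∑ a ∈ Finset.range N, (carlitzWordsFromHead m h a).card := by
  classical
  rw [← Finset.card_biUnion]
  · congr 1
    ext w
    simp only [Finset.mem_biUnion, Finset.mem_range, mem_carlitzWordsFromHead]
    constructor
    · intro hw
      have hw' := (mem_carlitzWordsFrom.mp hw).1
      cases w with
      | nil => exact absurd hw'.symm hm
      | cons a w => exact ⟨a, hN a (by simp [← hw']), hw, rfl⟩
    · rintro ⟨a, -, hw, -⟩
      exact hw
  · intro a _ b _ hab
    rw [Function.onFun, Finset.disjoint_left]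
    intro w hwa hwb
    rw [mem_carlitzWordsFromHead] at hwa hwb
    exact hab (Option.some.inj (hwa.2.symm.trans hwb.2))

/-- Deleting the leading a is a bijection onto the words of `m.erase a` that do not start with a; h'
is the threshold after the deletion. -/
theorem card_carlitzWordsFromHead_add {m : Multiset ℕ} {h h' a : ℕ} (ha : a ∈ m)
    (hord : ∀ w, IsOrderedFrom h (a :: w) ↔ IsOrderedFrom h' w) :
    (carlitzWordsFromHead m h a).card + (carlitzWordsFromHead (m.erase a) h' a).card
      = (carlitzWordsFrom (m.erase a) h').card := by
  classical
  have himg : carlitzWordsFromHead m h a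
      = ((carlitzWordsFrom (m.erase a) h').filter fun w => ¬ w.head? = some a).image
        (List.cons a) := by
    ext w
    simp only [mem_carlitzWordsFromHead, Finset.mem_image, Finset.mem_filter,
      mem_carlitzWordsFrom]
    constructor
    · rintro ⟨⟨rfl, hc, ho⟩, hh⟩
      obtain ⟨w, rfl⟩ := List.head?_eq_some_iff.mp hh
      rw [isCarlitz_cons] at hc
      exact ⟨w, ⟨⟨by simp, hc.1, (hord w).mp ho⟩, hc.2⟩, rfl⟩
    · rintro ⟨w, ⟨⟨he, hc, ho⟩, hh⟩, rfl⟩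
      refine ⟨⟨?_, isCarlitz_cons.mpr ⟨hc, hh⟩, (hord w).mpr ho⟩, rfl⟩
      rw [← Multiset.cons_coe, he, Multiset.cons_erase ha]
  rw [himg, Finset.card_image_of_injective _ List.cons_injective, add_comm,
    carlitzWordsFromHead]
  exact Finset.card_filter_add_card_filter_not _

/-! ### Counting words by the functional -/

section Weights

open Polynomial

/-- The product of the polynomials attached to the multiplicities of `0, …, N - 1` in `m`. -/
noncomputable def carlitzWeight (N : ℕ) (m : Multiset ℕ) : ℚ[X] :=
  ∏ i ∈ Finset.range N, carlitzPoly (m.count i)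

/-- The summand of the derivative of `carlitzWeight N m` in which the factor of `a` is
differentiated. -/
noncomputable def carlitzWeightHead (N : ℕ) (m : Multiset ℕ) (a : ℕ) : ℚ[X] :=
  (∏ i ∈ (Finset.range N).erase a, carlitzPoly (m.count i)) * derivative (carlitzPoly (m.count a))

theorem derivative_carlitzWeight (N : ℕ) (m : Multiset ℕ) :
    derivative (carlitzWeight N m) = ∑ a ∈ Finset.range N, carlitzWeightHead N m a :=
  Polynomial.derivative_prod_finset

theorem carlitzWeightHead_of_notMem {N : ℕ} {m : Multiset ℕ} {a : ℕ} (ha : a ∉ m) :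
    carlitzWeightHead N m a = 0 := by
  rw [carlitzWeightHead, Multiset.count_eq_zero_of_notMem ha]
  simp [carlitzPoly]

/-- The polynomial counterpart of `card_carlitzWordsFromHead_add`. -/
theorem carlitzWeightHead_of_mem {N : ℕ} {m : Multiset ℕ} {a : ℕ} (ha : a ∈ m) (haN : a < N) :
    carlitzWeightHead N m a
      = carlitzWeight N (m.erase a) - carlitzWeightHead N (m.erase a) a := by
  have hp : ∏ i ∈ (Finset.range N).erase a, carlitzPoly ((m.erase a).count i)
      = ∏ i ∈ (Finset.range N).erase a, carlitzPoly (m.count i) :=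
    Finset.prod_congr rfl fun i hi => by
      rw [Multiset.count_erase_of_ne (Finset.ne_of_mem_erase hi)]
  have hc : m.count a = (m.erase a).count a + 1 := by
    have := Multiset.count_pos.mpr ha
    rw [Multiset.count_erase_self]
    omega
  rw [carlitzWeight, ← Finset.prod_erase_mul _ _ (Finset.mem_range.mpr haN), carlitzWeightHead,
    carlitzWeightHead, hp, hc, derivative_carlitzPoly_succ, mul_sub]

theorem carlitzWeightHead_eq_of_count_eq {N : ℕ} {m : Multiset ℕ} {a b : ℕ} (ha : a < N)
    (hb : b < N) (hab : m.count a = m.count b) :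
    carlitzWeightHead N m a = carlitzWeightHead N m b := by
  rcases eq_or_ne a b with rfl | hne
  · rfl
  · rw [carlitzWeightHead, carlitzWeightHead, hab,
      ← Finset.mul_prod_erase ((Finset.range N).erase a) _
        (Finset.mem_erase.mpr ⟨hne.symm, Finset.mem_range.mpr hb⟩),
      ← Finset.mul_prod_erase ((Finset.range N).erase b) _
        (Finset.mem_erase.mpr ⟨hne, Finset.mem_range.mpr ha⟩), hab, Finset.erase_right_comm]

theorem eval_zero_carlitzWeight {N : ℕ} {m : Multiset ℕ} (hm : m ≠ 0) (hN : ∀ i ∈ m, i < N) :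
    (carlitzWeight N m).eval 0 = 0 := by
  obtain ⟨a, ha⟩ := Multiset.exists_mem_of_ne_zero hm
  rw [carlitzWeight, eval_prod]
  exact Finset.prod_eq_zero (Finset.mem_range.mpr (hN a ha))
    (eval_zero_carlitzPoly (Multiset.count_ne_zero.mpr ha))

theorem factorialFunctional_carlitzWeight {N : ℕ} {m : Multiset ℕ} (hm : m ≠ 0)
    (hN : ∀ i ∈ m, i < N) :
    factorialFunctional (carlitzWeight N m)
      = ∑ a ∈ Finset.range N, factorialFunctional (carlitzWeightHead N m a) := by
  rw [factorialFunctional_eq_eval_add_derivative, eval_zero_carlitzWeight hm hN, zero_add,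
    derivative_carlitzWeight, map_sum]

theorem carlitzWeight_zero (N : ℕ) : carlitzWeight N 0 = 1 := by
  simp [carlitzWeight, carlitzPoly]

/-- The numbers of Carlitz words, and of Carlitz words with a given first letter below `h`,
when the `u` letters from `h` on all have the same multiplicity and appear in order. -/
theorem card_carlitzWordsFrom_and_head {N k : ℕ} (hk : k ≠ 0) (m : Multiset ℕ) (h u : ℕ)
    (hN : ∀ i ∈ m, i < N) (hu : h + u = N) (hc : ∀ i, h ≤ i → i < N → m.count i = k) :
    ((carlitzWordsFrom m h).card : ℚ)
        = factorialFunctional (carlitzWeight N m) / u.factorial ∧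
      ∀ a < h, ((carlitzWordsFromHead m h a).card : ℚ)
        = factorialFunctional (carlitzWeightHead N m a) / u.factorial := by
  induction hn : m.card generalizing m h u with
  | zero =>
    rw [Multiset.card_eq_zero] at hn
    subst hn
    have hu0 : u = 0 := by
      by_contra hne
      exact hk (by rw [← hc h le_rfl (by omega), Multiset.count_zero])
    have h1 : carlitzWordsFrom 0 h = {[]} := by
      ext w
      rw [mem_carlitzWordsFrom, Multiset.coe_eq_zero, Finset.mem_singleton]
      refine ⟨fun H => H.1, ?_⟩
      rintro rfl
      exact ⟨rfl, by simp [IsCarlitz], by simp [IsOrderedFrom]⟩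
    refine ⟨?_, fun a _ => ?_⟩
    · have := factorialFunctional_monomial 0 1
      rw [h1, carlitzWeight_zero, hu0]
      simpa using this.symm
    · rw [carlitzWordsFromHead_eq_empty_of_notMem (Multiset.notMem_zero a),
        carlitzWeightHead_of_notMem (Multiset.notMem_zero a)]
      simp
  | succ l ih =>
    have hm : m ≠ 0 := by
      rintro rfl
      simp at hn
    -- Used twice: for a < h with the threshold unchanged, and for a = h, where h joins the letters
    -- already seen and one fewer unseen letter remains.
    have herase : ∀ a ∈ m, ∀ h' u', h ≤ h' → a < h' → h' + u' = N →
        (∀ w, IsOrderedFrom h (a :: w) ↔ IsOrderedFrom h' w) →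
        ((carlitzWordsFromHead m h a).card : ℚ)
          = factorialFunctional (carlitzWeightHead N m a) / u'.factorial := by
      intro a ha h' u' hhh hah hu' hord
      obtain ⟨i1, i2⟩ := ih (m.erase a) h' u' (fun i hi => hN i (Multiset.mem_of_mem_erase hi)) hu'
        (fun i hi hiN => by
          rw [Multiset.count_erase_of_ne (by omega), hc i (by omega) hiN])
        (by rw [Multiset.card_erase_of_mem ha, hn, Nat.pred_succ])
      have hcard := card_carlitzWordsFromHead_add ha hord
      have hcard' : ((carlitzWordsFromHead m h a).card : ℚ)
          + (carlitzWordsFromHead (m.erase a) h' a).card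
            = (carlitzWordsFrom (m.erase a) h').card := by exact_mod_cast hcard
      rw [carlitzWeightHead_of_mem ha (hN a ha), map_sub, sub_div, ← i1, ← i2 a hah]
      linarith
    have hhead : ∀ a < h, ((carlitzWordsFromHead m h a).card : ℚ)
        = factorialFunctional (carlitzWeightHead N m a) / u.factorial := by
      intro a ha
      by_cases ham : a ∈ m
      · exact herase a ham h u le_rfl ha hu fun w => isOrderedFrom_cons_of_lt ha
      · rw [carlitzWordsFromHead_eq_empty_of_notMem ham, carlitzWeightHead_of_notMem ham]
        simp
    refine ⟨?_, hhead⟩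
    rw [card_carlitzWordsFrom_eq_sum hm hN, factorialFunctional_carlitzWeight hm hN, ← hu,
      Finset.sum_range_add, Finset.sum_range_add, hu]
    push_cast
    rw [Finset.sum_congr rfl fun a ha => hhead a (Finset.mem_range.mp ha), add_div,
      Finset.sum_div]
    congr 1
    cases u with
    | zero => simp
    | succ u =>
      have hhm : h ∈ m := by
        rw [← Multiset.count_ne_zero, hc h le_rfl (by omega)]
        exact hk
      -- Only h can come first among the unseen letters, whereas the functional gives u + 1 equal
      -- terms; this factor turns (u + 1)! into u!.
      have hL : ∀ i ∈ Finset.range (u + 1),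
          factorialFunctional (carlitzWeightHead N m (h + i))
            = factorialFunctional (carlitzWeightHead N m h) := by
        intro i hi
        have hi' := Finset.mem_range.mp hi
        rw [carlitzWeightHead_eq_of_count_eq (b := h) (by omega) (by omega)
          (by rw [hc _ (by omega) (by omega), hc _ (by omega) (by omega)])]
      rw [Finset.sum_range_succ', Finset.sum_eq_zero fun i _ => by
          rw [carlitzWordsFromHead_eq_empty_of_lt hhm (by omega), Finset.card_empty,
            Nat.cast_zero],
        Finset.sum_congr rfl hL, Finset.sum_const, Finset.card_range, zero_add, add_zero,
        herase h hhm (h + 1) u (by omega) (by omega) (by omega)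
          fun w => isOrderedFrom_cons_self, Nat.factorial_succ]
      have hu1 : (u : ℚ) + 1 ≠ 0 := by positivity
      have hf : (u.factorial : ℚ) ≠ 0 := by positivity
      rw [nsmul_eq_mul]
      push_cast
      field_simp

/-! ### Specialization to four copies of each positive letter -/

theorem count_zero_letters (j n : ℕ) : (letters j n).count 0 = j := by
  rw [letters, Multiset.count_add, Multiset.count_replicate_self, Multiset.count_sum',
    Finset.sum_eq_zero, add_zero]
  intro i hi
  rw [Multiset.count_replicate, if_neg]
  have := (Finset.mem_Icc.mp hi).1
  omega

theorem count_letters {j n i : ℕ} (hi : 1 ≤ i) :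
    (letters j n).count i = if i ≤ n then 4 else 0 := by
  rw [letters, Multiset.count_add, Multiset.count_replicate, if_neg (by omega), zero_add,
    Multiset.count_sum']
  simp only [Multiset.count_replicate]
  rw [Finset.sum_ite_eq']
  simp [hi]

theorem lt_of_mem_letters {j n i : ℕ} (hi : i ∈ letters j n) : i < n + 1 := by
  by_contra! hlt
  rw [← Multiset.count_ne_zero, count_letters (by omega), if_neg (by omega)] at hi
  exact hi rfl

theorem prod_erase_zero_letters (j n : ℕ) :
    ∏ i ∈ (Finset.range (n + 1)).erase 0, carlitzPoly ((letters j n).count i)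
      = carlitzPoly 4 ^ n := by
  rw [Finset.prod_congr rfl (g := fun _ => carlitzPoly 4), Finset.prod_const,
    Finset.card_erase_of_mem (by simp), Finset.card_range, Nat.add_sub_cancel]
  intro i hi
  rw [Finset.mem_erase, Finset.mem_range] at hi
  rw [count_letters (by omega), if_pos (by omega)]

theorem card_carlitzWordsFrom_letters_and_head (j n : ℕ) :
    ((carlitzWordsFrom (letters j n) 1).card : ℚ)
        = factorialFunctional (carlitzWeight (n + 1) (letters j n)) / n.factorial ∧
      ∀ a < 1, ((carlitzWordsFromHead (letters j n) 1 a).card : ℚ)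
        = factorialFunctional (carlitzWeightHead (n + 1) (letters j n) a) / n.factorial :=
  card_carlitzWordsFrom_and_head (k := 4) (by norm_num) _ 1 n (fun _ => lt_of_mem_letters)
    (by omega) fun i hi hin => by rw [count_letters hi, if_pos (by omega)]

theorem orderedCarlitzCount_zero (n : ℕ) :
    (orderedCarlitzCount 0 n : ℚ) = carlitzMoment 1 n / n.factorial := by
  have h0 : 0 ∉ letters 0 n := by
    rw [← Multiset.count_eq_zero, count_zero_letters]
  have hw : orderedCarlitzWords (letters 0 n) = carlitzWordsFrom (letters 0 n) 1 := by
    ext w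
    simp only [orderedCarlitzWords, carlitzWordsFrom, Finset.mem_filter, Multiset.mem_toFinset,
      Multiset.mem_lists_iff]
    refine and_congr_right fun hwm => and_congr_right fun _ =>
      isOrdered_iff_isOrderedFrom_one fun hw => h0 ?_
    rw [hwm]
    exact hw
  rw [orderedCarlitzCount, hw, (card_carlitzWordsFrom_letters_and_head 0 n).1, carlitzWeight,
    ← Finset.prod_erase_mul _ _ (Finset.mem_range.mpr n.succ_pos), prod_erase_zero_letters,
    count_zero_letters, carlitzMoment, carlitzPoly, mul_comm]

theorem orderedCarlitzCount_of_ne_zero {j : ℕ} (hj : j ≠ 0) (n : ℕ) :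
    (orderedCarlitzCount j n : ℚ)
      = carlitzMoment (derivative (carlitzPoly j)) n / n.factorial := by
  have h0 : 0 ∈ letters j n := by
    rw [← Multiset.count_ne_zero, count_zero_letters]
    exact hj
  have hw : orderedCarlitzWords (letters j n) = carlitzWordsFromHead (letters j n) 1 0 := by
    ext w
    simp only [orderedCarlitzWords, carlitzWordsFromHead, carlitzWordsFrom, Finset.mem_filter,
      Multiset.mem_toFinset, Multiset.mem_lists_iff, and_assoc]
    refine and_congr_right fun hwm => and_congr_right fun _ => isOrdered_iff_head_eq_zero ?_
    rw [hwm] at h0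
    exact h0
  rw [orderedCarlitzCount, hw, (card_carlitzWordsFrom_letters_and_head j n).2 0 one_pos,
    carlitzWeightHead, prod_erase_zero_letters, count_zero_letters, carlitzMoment, mul_comm]

end Weights

theorem satisfiesRecurrences_orderedCarlitzCount :
    SatisfiesRecurrences (fun n => orderedCarlitzCount 0 n) (fun n => orderedCarlitzCount 3 n)
      (fun n => orderedCarlitzCount 2 n) := by
  simpa only [orderedCarlitzCount_zero, orderedCarlitzCount_of_ne_zero (j := 3) (by norm_num),
    orderedCarlitzCount_of_ne_zero (j := 2) (by norm_num)]
    using satisfiesRecurrences_carlitzMoment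

theorem mainTheorem7 (p q r : ℕ → ℚ) :
    SatisfiesRecurrences p q r ↔
      ∀ n : ℕ, p n = orderedCarlitzCount 0 n ∧
        q n = orderedCarlitzCount 3 n ∧
        r n = orderedCarlitzCount 2 n := by
  constructor
  · intro h n
    exact h.unique satisfiesRecurrences_orderedCarlitzCount n
  · intro h
    obtain rfl : p = fun n => (orderedCarlitzCount 0 n : ℚ) := funext fun n => (h n).1
    obtain rfl : q = fun n => (orderedCarlitzCount 3 n : ℚ) := funext fun n => (h n).2.1
    obtain rfl : r = fun n => (orderedCarlitzCount 2 n : ℚ) := funext fun n => (h n).2.2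
    exact satisfiesRecurrences_orderedCarlitzCount
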